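/- There is a universal constant $C>0$ such that the following holds. Let $s<n<p$ be nonnegative integers with $C s\log^3(p)/n<1\le s^2/n$, let $\sigma\ge 0$, and let $\beta\in\mathbb{R}^p$ have at most $s$ nonzero entries. Let $X\in\mathbb{R}^{n\times p}$ have i.i.d. entries $X_{i,k}\sim\mathcal N(0,1/n)$, let $\eta\in\mathbb{R}^n$ have i.i.d. entries $\eta_i\sim\mathcal N(0,\sigma^2)$, independent of $X$, and let $y=X\beta+\eta$. Put $L=\lfloor n/(2s)\rfloor$ and, for $j=1,\dots,\lfloor p/L\rfloor$, let $\Omega_j=\{(j-1)L+1,\dots,jL\}$ and let $X_{\Omega_j}\in\mathbb{R}^{n\times L}$ be the submatrix of $X$ with columns in $\Omega_j$. Take a singular value decomposition $X_{\Omega_j}=U_j\Sigma_jV_j$ ($U_j\in\mathbb{R}^{n\times n}$ and $V_j\in\mathbb{R}^{L\times L}$ orthogonal, $\Sigma_j\in\mathbb{R}^{n\times L}$ rectangular diagonal with nonnegative entries), set $Z_{\Omega_j}=U_jI_{n\times L}V_j$, where $I_{n\times L}$ is the rectangular identity matrix, and let $$S_j=\frac1L\,\bigl\|Z_{\Omega_j}^Ty\bigr\|_2^2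 .$$ Let $S_{(1)}\le S_{(2)}\le\cdots$ be the numbers $S_j$ in non-decreasing order, and define the greedy variance estimator $$\widehat\sigma^2=\frac{2L}{p}\sum_{j=1}^{\lfloor p/(2L)\rfloor}S_{(j)} .$$ Then, with probability at least $1-\frac4p-2\left(\frac sp\right)^s$ with respect to the joint draw of $X$ and $\eta$, for every choice of the singular value decompositions, $$\left|\widehat\sigma^2-\sigma^2\right|\le\frac{2s\|\beta\|_2^2}{n}+\frac{5\sigma^2}{\log p}+\frac{8\sigma^2s\log p}{n}+\frac{16\,s\,\sigma\|\beta\|_2^2\sqrt{\log p}}{n}.$$ -/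

import Mathlib

open MeasureTheory ProbabilityTheory
open scoped NNReal Matrix

namespace GVE

/-- The `n × L` rectangular identity matrix. -/
def rectId (n L : ℕ) : Matrix (Fin n) (Fin L) ℝ :=
  Matrix.of fun i l => if (i : ℕ) = (l : ℕ) then 1 else 0

/-- `A = U * D * V` is a (full) singular value decomposition: `U`, `V` are orthogonal, and `D` is
rectangular diagonal with nonnegative entries. The order of the singular values is not
prescribed. -/
structure IsSVD {n L : ℕ} (A : Matrix (Fin n) (Fin L) ℝ) (U : Matrix (Fin n) (Fin n) ℝ)
    (D : Matrix (Fin n) (Fin L) ℝ) (V : Matrix (Fin L) (Fin L) ℝ) : Prop where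
  left_orthogonal : U ∈ Matrix.orthogonalGroup (Fin n) ℝ
  right_orthogonal : V ∈ Matrix.orthogonalGroup (Fin L) ℝ
  diagonal : ∀ (i : Fin n) (l : Fin L), (i : ℕ) ≠ (l : ℕ) → D i l = 0
  nonneg : ∀ i l, 0 ≤ D i l
  eq_mul : A = U * D * V

/-- The `l`-th index of the `j`-th window of length `L` in `{0, …, p - 1}`. There are `⌊p / L⌋`
windows; window `j` is `{j * L, …, j * L + L - 1}`. -/
def windowIdx {p L : ℕ} (j : Fin (p / L)) (l : Fin L) : Fin p :=
  ⟨j * L + l, by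
    have h1 : (j + 1 : ℕ) * L ≤ p :=
      (Nat.mul_le_mul_right L (Nat.succ_le_of_lt j.isLt)).trans (Nat.div_mul_le_self p L)
    have h2 := l.isLt
    rw [Nat.add_mul, Nat.one_mul] at h1
    omega⟩

/-- The restriction of `X` to the columns in the `j`-th window. -/
def block {n p L : ℕ} (X : Matrix (Fin n) (Fin p) ℝ) (j : Fin (p / L)) :
    Matrix (Fin n) (Fin L) ℝ :=
  X.submatrix id (windowIdx j)

/-- `Z` is a regularized design matrix of `X` for the window size `L`: on each window, the block
of `Z` is `U * I * V` for some singular value decomposition `U * D * V` of the block of `X`.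
(If `L` does not divide `p`, the fewer than `L` columns outside the windows are never used.) -/
def IsRegularized {n p : ℕ} (L : ℕ) (X Z : Matrix (Fin n) (Fin p) ℝ) : Prop :=
  ∀ j : Fin (p / L), ∃ U D V, IsSVD (block X j) U D V ∧ block Z j = U * rectId n L * V

/-- The window estimators `S_j = (1 / L) * ∑_{i ∈ Ω_j} |(Zᵀ y)_i| ^ 2`. -/
noncomputable def windowEst {n p : ℕ} (L : ℕ) (Z : Matrix (Fin n) (Fin p) ℝ) (y : Fin n → ℝ)
    (j : Fin (p / L)) : ℝ :=
  (1 / (L : ℝ)) * ∑ l : Fin L, |(Zᵀ *ᵥ y) (windowIdx j l)| ^ 2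

theorem div_two_mul_le (p L : ℕ) : p / (2 * L) ≤ p / L := by
  rw [Nat.mul_comm, ← Nat.div_div_eq_div_mul]
  exact Nat.div_le_self _ _

/-- The greedy variance estimate `(2 * L / p) * ∑_{j = 1}^{p / (2 * L)} S_(j)`, where
`S_(1) ≤ S_(2) ≤ …` are the window estimators in non-decreasing order. -/
noncomputable def varianceEst {n p : ℕ} (L : ℕ) (Z : Matrix (Fin n) (Fin p) ℝ) (y : Fin n → ℝ) :
    ℝ :=
  (2 * (L : ℝ) / (p : ℝ)) * ∑ j : Fin (p / (2 * L)),
    windowEst L Z y (Tuple.sort (windowEst L Z y) (Fin.castLE (div_two_mul_le p L) j))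

end GVE

namespace GVE

/-! When a block of `X` has full column rank, `U * rectId n L * V` has orthonormal columns spanning
its column space. So `L * S_j` is the squared length of the projection of `y` onto that space,
whatever decomposition was chosen (`IsSVD.sum_sq_eq_projSq`); full rank holds almost surely.

Split `y` into the contribution of the window's own columns plus a remainder `r`. The remainder is
independent of the block, with i.i.d. centred Gaussian entries of variance `v`, where `σ² ≤ v ≤ σ² +
‖β‖²/n`. Given the block, the projected energy is `v` times a noncentral chi-square with `L` degrees
of freedom. A nonzero centre can only help the lower tail, so every `S_j` is at least `(1 - ε)σ²`;
the upper bound `(1 + ε)(σ² + ‖β‖²/n)` is needed only for windows that miss the support, where the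
centre is zero. This is `window_tail`.

The rest is deterministic (`abs_varianceEst_sub_le`): at most `s` windows meet the support and at
least `s` are discarded, so every retained order statistic obeys both bounds. With `ε = 1 / log p` a
union bound costs at most `2 / p`, and the first two error terms already suffice. -/

/-! ### Chernoff bounds for noncentral chi-square variables -/

theorem integral_exp_mul_add_sq_gaussianReal {a : ℝ} (ha : a < 1 / 2) (c : ℝ) :
    ∫ x, Real.exp (a * (c + x) ^ 2) ∂(gaussianReal 0 1) =
      Real.exp (a * c ^ 2 / (1 - 2 * a)) / √(1 - 2 * a) := by
  have hq : 0 < 1 - 2 * a := by linarith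
  rw [integral_gaussianReal_eq_integral_smul one_ne_zero]
  have h1 : ∀ x : ℝ, gaussianPDFReal 0 1 x • Real.exp (a * (c + x) ^ 2) =
      ((√(2 * Real.pi))⁻¹ * Real.exp (a * c ^ 2 / (1 - 2 * a))) *
        Real.exp (-((1 - 2 * a) / 2) * (x - 2 * a * c / (1 - 2 * a)) ^ 2) := by
    intro x
    simp only [gaussianPDFReal, NNReal.coe_one, mul_one, sub_zero, smul_eq_mul]
    rw [mul_assoc, mul_assoc, ← Real.exp_add, ← Real.exp_add]
    congr 2
    field_simp
    ring
  simp_rw [h1]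
  rw [integral_const_mul,
    integral_sub_right_eq_self (fun x : ℝ => Real.exp (-((1 - 2 * a) / 2) * x ^ 2)),
    integral_gaussian]
  have h2 : Real.pi / ((1 - 2 * a) / 2) = (2 * Real.pi) / (1 - 2 * a) := by
    field_simp
  rw [h2, Real.sqrt_div (by positivity)]
  have : √(2 * Real.pi) ≠ 0 := by positivity
  field_simp

theorem mgf_sum_add_sq_pi_gaussianReal {L : ℕ} {a : ℝ} (ha : a < 1 / 2) (c : Fin L → ℝ) :
    mgf (fun z : Fin L → ℝ => ∑ l, (c l + z l) ^ 2)
      (Measure.pi fun _ : Fin L => gaussianReal 0 1) a =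
      ∏ l, (Real.exp (a * c l ^ 2 / (1 - 2 * a)) / √(1 - 2 * a)) := by
  simp_rw [mgf, Finset.mul_sum, Real.exp_sum]
  rw [integral_fintype_prod_eq_prod (fun (l : Fin L) (x : ℝ) => Real.exp (a * (c l + x) ^ 2))]
  simp_rw [integral_exp_mul_add_sq_gaussianReal ha]

/-- A non-integrable function has Bochner integral `0` by convention, whereas the closed form of the
mgf is positive. -/
theorem integrable_exp_sum_add_sq {L : ℕ} {a : ℝ} (ha : a < 1 / 2) (c : Fin L → ℝ) :
    Integrable (fun z : Fin L → ℝ => Real.exp (a * ∑ l, (c l + z l) ^ 2))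
      (Measure.pi fun _ : Fin L => gaussianReal 0 1) := by
  have hq : 0 < 1 - 2 * a := by linarith
  by_contra h
  have h1 := mgf_sum_add_sq_pi_gaussianReal ha c
  rw [mgf, integral_undef h] at h1
  have : 0 < ∏ l, (Real.exp (a * c l ^ 2 / (1 - 2 * a)) / √(1 - 2 * a)) :=
    Finset.prod_pos fun l _ => by positivity
  linarith

theorem gaussian_upper_tail (L : ℕ) {ε : ℝ} (h0 : 0 ≤ ε) (h1 : ε ≤ 1) :
    (Measure.pi fun _ : Fin L => gaussianReal 0 1).real
      {z : Fin L → ℝ | (1 + ε) * L ≤ ∑ l, z l ^ 2} ≤ Real.exp (-(L * ε ^ 2 / 16)) := by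
  have ha : ε / 4 < 1 / 2 := by linarith
  have hq : 0 < 1 - 2 * (ε / 4) := by linarith
  have key := measure_ge_le_exp_mul_mgf (μ := Measure.pi fun _ : Fin L => gaussianReal 0 1)
    (X := fun z : Fin L → ℝ => ∑ l, ((0 : Fin L → ℝ) l + z l) ^ 2) (t := ε / 4) ((1 + ε) * L)
    (by positivity) (integrable_exp_sum_add_sq ha 0)
  rw [mgf_sum_add_sq_pi_gaussianReal ha] at key
  simp only [Pi.zero_apply, zero_add] at key
  refine key.trans ?_
  simp only [ne_eq, OfNat.ofNat_ne_zero, not_false_eq_true, zero_pow, mul_zero, zero_div,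
    Real.exp_zero, Finset.prod_const, Finset.card_univ, Fintype.card_fin]
  -- Second-order expansion of `log (1 - ε / 2)`: the quadratic term gives `ε² / 8` and the
  -- remainder at most `ε² / 4`. With `t = ε / 4` the exponent per coordinate is then exactly `-ε² /
  -- 16`.
  have hlog : -(ε / 2 + 3 * ε ^ 2 / 8) ≤ Real.log (1 - 2 * (ε / 4)) := by
    have habs : |ε / 2| = ε / 2 := abs_of_nonneg (by linarith)
    have h3 := Real.abs_log_sub_add_sum_range_le (x := ε / 2) (by rw [habs]; linarith) 2
    rw [habs] at h3
    have h4 : (ε / 2) ^ (2 + 1) / (1 - ε / 2) ≤ ε ^ 2 / 4 := by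
      rw [div_le_iff₀ (by linarith)]
      nlinarith [mul_nonneg (sq_nonneg ε) (sub_nonneg.2 h1)]
    have h5 := (abs_le.1 h3).1
    simp only [Finset.sum_range_succ, Finset.sum_range_zero] at h5
    have h6 : 1 - 2 * (ε / 4) = 1 - ε / 2 := by ring
    rw [h6]
    norm_num at h5
    linarith
  have h2 : 1 / √(1 - 2 * (ε / 4)) ≤ Real.exp ((ε / 2 + 3 * ε ^ 2 / 8) / 2) := by
    rw [one_div, ← Real.exp_log (Real.sqrt_pos.2 hq), ← Real.exp_neg, Real.log_sqrt hq.le]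
    exact Real.exp_le_exp.2 (by linarith)
  calc _ ≤ Real.exp (-(ε / 4) * ((1 + ε) * L)) * Real.exp ((ε / 2 + 3 * ε ^ 2 / 8) / 2) ^ L := by
        gcongr
    _ = _ := by
        rw [← Real.exp_nat_mul, ← Real.exp_add]
        congr 1
        ring

theorem gaussian_lower_tail {L : ℕ} (c : Fin L → ℝ) {ε : ℝ} (h0 : 0 ≤ ε) :
    (Measure.pi fun _ : Fin L => gaussianReal 0 1).real
      {z : Fin L → ℝ | ∑ l, (c l + z l) ^ 2 ≤ (1 - ε) * L} ≤ Real.exp (-(L * ε ^ 2 / 16)) := by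
  have ha : -(ε / 2) < 1 / 2 := by linarith
  have hq : 0 < 1 - 2 * (-(ε / 2)) := by linarith
  have key := measure_le_le_exp_mul_mgf (μ := Measure.pi fun _ : Fin L => gaussianReal 0 1)
    (X := fun z : Fin L → ℝ => ∑ l, (c l + z l) ^ 2) (t := -(ε / 2)) ((1 - ε) * L)
    (by linarith) (integrable_exp_sum_add_sq ha c)
  rw [mgf_sum_add_sq_pi_gaussianReal ha] at key
  refine key.trans ?_
  have hlog : 2 * ε / (ε + 2) ≤ Real.log (1 - 2 * (-(ε / 2))) := by
    have := Real.le_log_one_add_of_nonneg h0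
    convert this using 2
    ring
  have hlog' : ε - ε ^ 2 / 2 ≤ 2 * ε / (ε + 2) := by
    rw [le_div_iff₀ (by linarith)]
    nlinarith [pow_nonneg h0 3]
  have h2 : ∀ l, Real.exp (-(ε / 2) * c l ^ 2 / (1 - 2 * (-(ε / 2)))) / √(1 - 2 * (-(ε / 2)))
      ≤ Real.exp (-(ε - ε ^ 2 / 2) / 2) := by
    intro l
    -- The tilt is negative, so the factor carrying the centre is at most `1`; the bound is uniform
    -- in `c`.
    have h3 : Real.exp (-(ε / 2) * c l ^ 2 / (1 - 2 * (-(ε / 2)))) ≤ 1 := by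
      rw [Real.exp_le_one_iff]
      apply div_nonpos_of_nonpos_of_nonneg _ hq.le
      nlinarith [sq_nonneg (c l)]
    refine (div_le_div_of_nonneg_right h3 (Real.sqrt_nonneg _)).trans ?_
    rw [one_div, ← Real.exp_log (Real.sqrt_pos.2 hq), ← Real.exp_neg, Real.log_sqrt hq.le]
    exact Real.exp_le_exp.2 (by linarith)
  calc _ ≤ Real.exp (-(-(ε / 2)) * ((1 - ε) * L)) *
        ∏ _l : Fin L, Real.exp (-(ε - ε ^ 2 / 2) / 2) := by
        gcongr with l
        exact h2 l
    _ ≤ _ := by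
        rw [Finset.prod_const, Finset.card_univ, Fintype.card_fin, ← Real.exp_nat_mul,
          ← Real.exp_add]
        apply Real.exp_le_exp.2
        have : 0 ≤ (L : ℝ) * ε ^ 2 := by positivity
        linarith

/-! ### Linear images of Gaussian vectors; absolute continuity of product measures -/

/-- Comparison of characteristic functions. The hypothesis says, as an identity of quadratic forms,
that `T diag(v) Tᵀ = diag(w)`; variances may vanish. -/
theorem map_mulVec_pi_gaussianReal {ι κ : Type*} [Fintype ι] [Fintype κ]
    (v : ι → ℝ≥0) (w : κ → ℝ≥0) (T : Matrix κ ι ℝ)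
    (hT : ∀ t : κ → ℝ, ∑ e, (v e : ℝ) * (∑ k, T k e * t k) ^ 2 = ∑ k, (w k : ℝ) * t k ^ 2) :
    (Measure.pi fun e => gaussianReal 0 (v e)).map (T *ᵥ ·) =
      Measure.pi fun k => gaussianReal 0 (w k) := by
  have hm : Measurable (fun x : ι → ℝ => T *ᵥ x) :=
    (Matrix.mulVecLin T).continuous_of_finiteDimensional.measurable
  have : IsProbabilityMeasure ((Measure.pi fun e => gaussianReal 0 (v e)).map (T *ᵥ ·)) :=
    Measure.isProbabilityMeasure_map hm.aemeasurable
  rw [← charFun_eq_pi_iff]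
  intro t
  rw [Measure.map_map (by fun_prop) hm, charFun_apply, integral_map (by fun_prop) (by fun_prop)]
  have h1 : ∀ x : ι → ℝ, Complex.exp (((inner ℝ ((WithLp.toLp 2 ∘ fun x => T *ᵥ x) x) t : ℝ) : ℂ)
      * Complex.I) = ∏ e, Complex.exp (((∑ k, T k e * t k : ℝ) : ℂ) * (x e : ℂ) * Complex.I) := by
    intro x
    rw [← Complex.exp_sum, ← Finset.sum_mul]
    congr 2
    simp only [Function.comp, PiLp.inner_apply, Matrix.mulVec, dotProduct]
    push_cast
    simp_rw [Finset.sum_mul]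
    rw [Finset.sum_comm]
    refine Finset.sum_congr rfl fun k _ => ?_
    simp [Finset.mul_sum]
    exact Finset.sum_congr rfl fun e _ => by ring
  simp_rw [h1]
  rw [integral_fintype_prod_eq_prod (fun (e : ι) (x : ℝ) =>
    Complex.exp (((∑ k, T k e * t k : ℝ) : ℂ) * (x : ℂ) * Complex.I))]
  simp_rw [← charFun_apply_real, charFun_gaussianReal, ← Complex.exp_sum]
  congr 1
  have := congrArg (fun x : ℝ => (x : ℂ)) (hT t)
  push_cast at this ⊢
  simp only [mul_zero, zero_mul, zero_sub, Finset.sum_neg_distrib, ← Finset.sum_div]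
  rw [this]

theorem absolutelyContinuous_pi_fin {n : ℕ} {μ ν : Fin n → Measure ℝ}
    [∀ i, SigmaFinite (μ i)] [∀ i, SigmaFinite (ν i)] (h : ∀ i, μ i ≪ ν i) :
    Measure.pi μ ≪ Measure.pi ν := by
  induction n with
  | zero =>
    have : μ = ν := Subsingleton.elim _ _
    rw [this]
  | succ n ih =>
    rw [← (measurePreserving_piFinSuccAbove μ 0).symm.map_eq,
      ← (measurePreserving_piFinSuccAbove ν 0).symm.map_eq]
    exact ((h 0).prod (ih fun i => h _)).map (MeasurableEquiv.measurable _)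

theorem absolutelyContinuous_pi {ι : Type*} [Fintype ι] {μ ν : ι → Measure ℝ}
    [∀ i, SigmaFinite (μ i)] [∀ i, SigmaFinite (ν i)] (h : ∀ i, μ i ≪ ν i) :
    Measure.pi μ ≪ Measure.pi ν := by
  let e := (Fintype.equivFin ι).symm
  rw [← (measurePreserving_piCongrLeft μ e).map_eq, ← (measurePreserving_piCongrLeft ν e).map_eq]
  exact (absolutelyContinuous_pi_fin fun i => h _).map (MeasurableEquiv.measurable _)

/-! ### Projection energy and its independence of the decomposition -/

/-- The squared norm of the orthogonal projection of `y` onto the column space of `A`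
(for `A` of full column rank). -/
noncomputable def projSq {n L : ℕ} (A : Matrix (Fin n) (Fin L) ℝ) (y : Fin n → ℝ) : ℝ :=
  y ⬝ᵥ ((A * (Aᵀ * A)⁻¹ * Aᵀ) *ᵥ y)

theorem projSq_mul {n L : ℕ} {Z : Matrix (Fin n) (Fin L) ℝ} {M : Matrix (Fin L) (Fin L) ℝ}
    (hZ : Zᵀ * Z = 1) (hM : IsUnit M.det) (y : Fin n → ℝ) :
    projSq (Z * M) y = ∑ l, (Zᵀ *ᵥ y) l ^ 2 := by
  have hMT : IsUnit Mᵀ.det := by rwa [Matrix.det_transpose]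
  have h1 : (Z * M)ᵀ * (Z * M) = Mᵀ * M := by
    rw [Matrix.transpose_mul, Matrix.mul_assoc, ← Matrix.mul_assoc Zᵀ, hZ, Matrix.one_mul]
  have h2 : Z * M * (Mᵀ * M)⁻¹ * (Z * M)ᵀ = Z * Zᵀ := by
    rw [Matrix.mul_inv_rev, Matrix.transpose_mul]
    calc Z * M * (M⁻¹ * Mᵀ⁻¹) * (Mᵀ * Zᵀ) = Z * (M * M⁻¹) * (Mᵀ⁻¹ * Mᵀ) * Zᵀ := by
          simp only [Matrix.mul_assoc]
      _ = Z * Zᵀ := by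
          rw [Matrix.mul_nonsing_inv _ hM, Matrix.nonsing_inv_mul _ hMT, Matrix.mul_one,
            Matrix.mul_one]
  rw [projSq, h1, h2, ← Matrix.mulVec_mulVec, Matrix.dotProduct_mulVec, ← Matrix.mulVec_transpose,
    dotProduct]
  exact Finset.sum_congr rfl fun l _ => by ring

/-- Factor the Gram matrix as `Mᵀ * M` and take `Z = A * M⁻¹`. -/
theorem exists_orthonormal_mul {n L : ℕ} (A : Matrix (Fin n) (Fin L) ℝ)
    (hA : (Aᵀ * A).det ≠ 0) :
    ∃ (Z : Matrix (Fin n) (Fin L) ℝ) (M : Matrix (Fin L) (Fin L) ℝ),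
      Zᵀ * Z = 1 ∧ IsUnit M.det ∧ A = Z * M := by
  have hpos : (Aᵀ * A).PosSemidef := by
    simpa using Matrix.posSemidef_conjTranspose_mul_self A
  obtain ⟨M, hM⟩ : ∃ M : Matrix (Fin L) (Fin L) ℝ, Aᵀ * A = Mᵀ * M := by
    open scoped MatrixOrder in
    obtain ⟨M, hM⟩ := CStarAlgebra.nonneg_iff_eq_star_mul_self.1 hpos.nonneg
    exact ⟨M, by simpa [Matrix.star_eq_conjTranspose] using hM⟩
  have hdet : IsUnit M.det := by
    rw [hM, Matrix.det_mul] at hA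
    exact isUnit_iff_ne_zero.2 (right_ne_zero_of_mul hA)
  have hMT : IsUnit Mᵀ.det := by rwa [Matrix.det_transpose]
  refine ⟨A * M⁻¹, M, ?_, hdet, ?_⟩
  · rw [Matrix.transpose_mul, Matrix.mul_assoc, ← Matrix.mul_assoc Aᵀ, hM, Matrix.mul_assoc,
      Matrix.mul_nonsing_inv _ hdet, Matrix.mul_one, Matrix.transpose_nonsing_inv,
      Matrix.nonsing_inv_mul _ hMT]
  · rw [Matrix.mul_assoc, Matrix.nonsing_inv_mul _ hdet, Matrix.mul_one]

theorem rectId_mul_apply {n L : ℕ} (D : Matrix (Fin L) (Fin L) ℝ) (i : Fin n)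
    (l : Fin L) :
    (rectId n L * D) i l = if h : (i : ℕ) < L then D ⟨i, h⟩ l else 0 := by
  simp only [Matrix.mul_apply, rectId, Matrix.of_apply]
  split_ifs with h
  · rw [Finset.sum_eq_single ⟨i, h⟩]
    · simp
    · intro b _ hb
      rw [if_neg, zero_mul]
      rintro h'
      exact hb (Fin.ext h'.symm)
    · simp
  · refine Finset.sum_eq_zero fun b _ => ?_
    rw [if_neg, zero_mul]
    have := b.isLt
    omega

theorem rectId_transpose_mul_self {n L : ℕ} (hL : L ≤ n) : (rectId n L)ᵀ * rectId n L = 1 := by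
  ext a b
  rw [Matrix.mul_apply, Finset.sum_eq_single (Fin.castLE hL a)]
  · simp [rectId, Matrix.one_apply, Fin.ext_iff]
  · intro i _ hi
    simp only [Matrix.transpose_apply, rectId, Matrix.of_apply]
    rw [if_neg, zero_mul]
    exact fun h => hi (Fin.ext h)
  · simp

theorem IsSVD.sum_sq_eq_projSq {n L : ℕ} (hL : L ≤ n) {A : Matrix (Fin n) (Fin L) ℝ}
    {U D V} (h : IsSVD A U D V) (hA : (Aᵀ * A).det ≠ 0) (y : Fin n → ℝ) :
    ∑ l, ((U * rectId n L * V)ᵀ *ᵥ y) l ^ 2 = projSq A y := by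
  have hU : Uᵀ * U = 1 := by
    simpa [Matrix.star_eq_conjTranspose] using (Matrix.mem_orthogonalGroup_iff' _ _).1
      h.left_orthogonal
  have hV : Vᵀ * V = 1 := by
    simpa [Matrix.star_eq_conjTranspose] using (Matrix.mem_orthogonalGroup_iff' _ _).1
      h.right_orthogonal
  have hV' : V * Vᵀ = 1 := mul_eq_one_comm.1 hV
  let Δ : Matrix (Fin L) (Fin L) ℝ := Matrix.of fun a b => D (Fin.castLE hL a) b
  have hD : D = rectId n L * Δ := by
    ext i l
    rw [rectId_mul_apply]
    split_ifs with hi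
    · rfl
    · refine h.diagonal i l ?_
      have := l.isLt
      omega
  have hZ : (U * rectId n L * V)ᵀ * (U * rectId n L * V) = 1 := by
    calc _ = Vᵀ * ((rectId n L)ᵀ * (Uᵀ * U) * rectId n L) * V := by
          simp only [Matrix.transpose_mul, Matrix.mul_assoc]
      _ = 1 := by rw [hU, Matrix.mul_one, rectId_transpose_mul_self hL, Matrix.mul_one, hV]
  have hfac : A = U * rectId n L * V * (Vᵀ * Δ * V) := by
    calc A = U * (rectId n L * Δ) * V := by rw [← hD]; exact h.eq_mul
      _ = U * rectId n L * (V * Vᵀ) * Δ * V := by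
          rw [hV', Matrix.mul_one]; simp only [Matrix.mul_assoc]
      _ = _ := by simp only [Matrix.mul_assoc]
  have hM : IsUnit (Vᵀ * Δ * V).det := by
    rw [hfac, Matrix.transpose_mul, Matrix.mul_assoc, ← Matrix.mul_assoc (U * rectId n L * V)ᵀ, hZ,
      Matrix.one_mul, Matrix.det_mul] at hA
    exact isUnit_iff_ne_zero.2 (right_ne_zero_of_mul hA)
  rw [hfac, projSq_mul hZ hM]

/-! ### Full column rank and measurability -/

theorem det_transpose_mul_self_ne_zero {n L : ℕ} (hL : L ≤ n) {A : Matrix (Fin n) (Fin L) ℝ}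
    (hA : (A.submatrix (Fin.castLE hL) id).det ≠ 0) : (Aᵀ * A).det ≠ 0 := by
  intro h
  obtain ⟨v, hv, h0⟩ := Matrix.exists_mulVec_eq_zero_iff.2 h
  refine hA (Matrix.exists_mulVec_eq_zero_iff.1 ⟨v, hv, ?_⟩)
  have h1 : (A *ᵥ v) ⬝ᵥ (A *ᵥ v) = 0 := by
    rw [Matrix.dotProduct_mulVec, ← Matrix.mulVec_transpose, Matrix.mulVec_mulVec, h0,
      zero_dotProduct]
  have h2 := dotProduct_self_eq_zero.1 h1
  ext a
  exact congrFun h2 (Fin.castLE hL a)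

theorem measurable_projSq (n L : ℕ) :
    Measurable fun q : (Fin n × Fin L → ℝ) × (Fin n → ℝ) =>
      projSq (Matrix.of fun i l => q.1 (i, l)) q.2 := by
  have h : ∀ q : (Fin n × Fin L → ℝ) × (Fin n → ℝ),
      projSq (Matrix.of fun i l => q.1 (i, l)) q.2 =
        (Matrix.det ((Matrix.of fun i l => q.1 (i, l))ᵀ * Matrix.of fun i l => q.1 (i, l)))⁻¹ *
        (q.2 ⬝ᵥ (((Matrix.of fun i l => q.1 (i, l)) *
          Matrix.adjugate ((Matrix.of fun i l => q.1 (i, l))ᵀ * Matrix.of fun i l => q.1 (i, l)) *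
          (Matrix.of fun i l => q.1 (i, l))ᵀ) *ᵥ q.2)) := by
    intro q
    -- Cramer's formula leaves the inverse of a determinant times a polynomial in the entries.
    rw [projSq, Matrix.inv_def, Ring.inverse_eq_inv', Matrix.mul_smul, Matrix.smul_mul,
      Matrix.smul_mulVec, dotProduct_smul, smul_eq_mul]
  simp_rw [h]
  have hc : Continuous fun q : (Fin n × Fin L → ℝ) × (Fin n → ℝ) =>
      (Matrix.of fun i l => q.1 (i, l) : Matrix (Fin n) (Fin L) ℝ) := by
    refine continuous_matrix fun i l => ?_
    simp only [Matrix.of_apply]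
    fun_prop
  refine Measurable.mul (Measurable.inv ?_) ?_
  · exact (hc.matrix_transpose.matrix_mul hc).matrix_det.measurable
  · refine Continuous.measurable ?_
    exact continuous_snd.dotProduct (((hc.matrix_mul
      (hc.matrix_transpose.matrix_mul hc).matrix_adjugate).matrix_mul
        hc.matrix_transpose).matrix_mulVec continuous_snd)

/-- A matrix with independent, absolutely continuous entries has full column rank. -/
theorem ae_det_transpose_mul_self_ne_zero {n L : ℕ} (hL : L ≤ n)
    {μ : Fin n × Fin L → Measure ℝ} [∀ e, SigmaFinite (μ e)] (hμ : ∀ e, μ e ≪ volume) :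
    ∀ᵐ x ∂(Measure.pi μ), ((Matrix.of fun i l => x (i, l))ᵀ *
      (Matrix.of fun i l => x (i, l) : Matrix (Fin n) (Fin L) ℝ)).det ≠ 0 := by
  have hac : Measure.pi μ ≪ (volume : Measure (Fin n × Fin L → ℝ)) :=
    absolutelyContinuous_pi hμ
  refine hac.ae_le ?_
  let T : (Fin n × Fin L → ℝ) → Matrix (Fin L) (Fin L) ℝ :=
    fun x => Matrix.of fun a b => x (Fin.castLE hL a, b)
  have hT : Continuous T := continuous_matrix fun i l => by
    simp only [T, Matrix.of_apply]
    fun_prop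
  have hs : MeasurableSet {x | (T x).det ≠ 0} :=
    (hT.matrix_det.measurable (measurableSet_singleton 0)).compl
  -- Moving by `t` along `v` adds `t` times the identity to the top square block. On each such line
  -- the singular parameters are roots of a monic characteristic polynomial, hence finitely many.
  let v : Fin n × Fin L → ℝ := fun e => if (e.1 : ℕ) = (e.2 : ℕ) then 1 else 0
  have key : ∀ᵐ y ∂(volume : Measure (Fin n × Fin L → ℝ)), y ∈ {x | (T x).det ≠ 0} := by
    refine ae_mem_of_ae_add_linearMap_mem (LinearMap.toSpanSingleton ℝ _ v) volume volume hs ?_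
    intro y
    have hsub : {t : ℝ | ¬ (y + LinearMap.toSpanSingleton ℝ _ v t ∈ {x | (T x).det ≠ 0})} ⊆
        {t | (-(T y)).charpoly.IsRoot t} := by
      intro t ht
      simp only [Set.mem_ofPred_eq, not_not] at ht
      rw [Set.mem_ofPred_eq, Polynomial.IsRoot, Matrix.eval_charpoly, sub_neg_eq_add, ← ht]
      congr 1
      ext a b
      by_cases hab : a = b
      · simp [T, v, hab, add_comm]
      · simp [T, v, hab, Fin.val_inj]
    rw [ae_iff]
    exact measure_mono_null hsub
      ((Polynomial.finite_setOfPred_isRoot (Matrix.charpoly_monic _).ne_zero).measure_zero _)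
  filter_upwards [key] with x hx
  exact det_transpose_mul_self_ne_zero hL hx

/-! ### Tail bounds for projected Gaussian noise -/

theorem pi_gaussianReal_map_smul {L : ℕ} (v : ℝ≥0) :
    (Measure.pi fun _ : Fin L => gaussianReal 0 1).map
      ((√(v : ℝ) • (1 : Matrix (Fin L) (Fin L) ℝ)) *ᵥ ·) =
      Measure.pi fun _ : Fin L => gaussianReal 0 v := by
  refine map_mulVec_pi_gaussianReal (fun _ => 1) (fun _ => v) _ fun t => ?_
  refine Finset.sum_congr rfl fun e _ => ?_
  simp [Matrix.one_apply, mul_pow]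

theorem pi_gaussianReal_map_transpose {n L : ℕ} (v : ℝ≥0) {Z : Matrix (Fin n) (Fin L) ℝ}
    (hZ : Zᵀ * Z = 1) :
    (Measure.pi fun _ : Fin n => gaussianReal 0 v).map (Zᵀ *ᵥ ·) =
      Measure.pi fun _ : Fin L => gaussianReal 0 v := by
  refine map_mulVec_pi_gaussianReal (fun _ => v) (fun _ => v) _ fun t => ?_
  rw [← Finset.mul_sum, ← Finset.mul_sum]
  congr 1
  have h1 : (Z *ᵥ t) ⬝ᵥ (Z *ᵥ t) = t ⬝ᵥ t := by
    rw [Matrix.dotProduct_mulVec, ← Matrix.mulVec_transpose, Matrix.mulVec_mulVec, hZ,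
      Matrix.one_mulVec]
  simp only [dotProduct, Matrix.mulVec] at h1
  simpa [pow_two] using h1

theorem measurable_mulVec {ι κ : Type*} [Fintype ι] [Fintype κ] (T : Matrix κ ι ℝ) :
    Measurable (fun x : ι → ℝ => T *ᵥ x) :=
  (Matrix.mulVecLin T).continuous_of_finiteDimensional.measurable

/-- Transfer of an event on projected Gaussian noise to a standard Gaussian vector. -/
theorem pi_gaussianReal_transpose_preimage {n L : ℕ} (v : ℝ≥0) {Z : Matrix (Fin n) (Fin L) ℝ}
    (hZ : Zᵀ * Z = 1) {S : Set (Fin L → ℝ)} (hS : MeasurableSet S) :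
    (Measure.pi fun _ : Fin n => gaussianReal 0 v) {r | Zᵀ *ᵥ r ∈ S} =
      (Measure.pi fun _ : Fin L => gaussianReal 0 1) {z | (fun l => √(v : ℝ) * z l) ∈ S} := by
  have h1 := Measure.map_apply (μ := Measure.pi fun _ : Fin n => gaussianReal 0 v)
    (measurable_mulVec Zᵀ) hS
  rw [pi_gaussianReal_map_transpose v hZ, ← pi_gaussianReal_map_smul v,
    Measure.map_apply (measurable_mulVec _) hS] at h1
  refine h1.symm.trans ?_
  congr 1
  ext z
  simp only [Set.mem_preimage, Set.mem_ofPred_eq]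
  have : (√(v : ℝ) • (1 : Matrix (Fin L) (Fin L) ℝ)) *ᵥ z = fun l => √(v : ℝ) * z l := by
    rw [Matrix.smul_mulVec, Matrix.one_mulVec]
    rfl
  rw [this]

theorem projSq_lower_tail {n L : ℕ} {A : Matrix (Fin n) (Fin L) ℝ} (hA : (Aᵀ * A).det ≠ 0)
    (b : Fin L → ℝ) (v : ℝ≥0) {ε : ℝ} (h0 : 0 ≤ ε) :
    (Measure.pi fun _ : Fin n => gaussianReal 0 v)
      {r | projSq A (A *ᵥ b + r) < (1 - ε) * (v * L)} ≤
        ENNReal.ofReal (Real.exp (-(L * ε ^ 2 / 16))) := by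
  obtain ⟨Z, M, hZ, hM, rfl⟩ := exists_orthonormal_mul A hA
  have h1 : ∀ r, projSq (Z * M) ((Z * M) *ᵥ b + r) =
      ∑ l, ((M *ᵥ b) l + (Zᵀ *ᵥ r) l) ^ 2 := by
    intro r
    rw [projSq_mul hZ hM, Matrix.mulVec_add, Matrix.mulVec_mulVec, ← Matrix.mul_assoc, hZ,
      Matrix.one_mul]
    rfl
  simp_rw [h1]
  have hS : MeasurableSet {g : Fin L → ℝ | ∑ l, ((M *ᵥ b) l + g l) ^ 2 < (1 - ε) * (v * L)} :=
    measurableSet_lt (by fun_prop) (by fun_prop)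
  refine (pi_gaussianReal_transpose_preimage v hZ hS).trans_le ?_
  -- The centre is rescaled by `1 / √v` below. For `v = 0` the strict inequality makes the event
  -- empty.
  rcases eq_zero_or_pos v with rfl | hv
  · refine (measure_mono_null ?_ measure_empty).le.trans zero_le
    intro z hz
    simp only [Set.mem_ofPred_eq, NNReal.coe_zero, zero_mul, mul_zero] at hz
    exact absurd hz (not_lt.2 (Finset.sum_nonneg fun _ _ => sq_nonneg _))
  · rw [ENNReal.le_ofReal_iff_toReal_le (measure_ne_top _ _) (Real.exp_pos _).le]
    refine le_trans (measureReal_mono ?_) (gaussian_lower_tail (fun l => (M *ᵥ b) l / √v) h0)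
    intro z hz
    simp only [Set.mem_ofPred_eq] at hz ⊢
    have hv' : 0 < √(v : ℝ) := Real.sqrt_pos.2 hv
    have h2 : ∑ l, ((M *ᵥ b) l + √(v : ℝ) * z l) ^ 2 =
        v * ∑ l, ((M *ᵥ b) l / √v + z l) ^ 2 := by
      rw [Finset.mul_sum]
      refine Finset.sum_congr rfl fun l _ => ?_
      rw [show (v : ℝ) = √v ^ 2 from (Real.sq_sqrt v.2).symm, ← mul_pow]
      congr 1
      rw [Real.sqrt_sq hv'.le]
      field_simp
    rw [h2, mul_left_comm] at hz
    exact (lt_of_mul_lt_mul_left hz v.2).le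

theorem projSq_upper_tail {n L : ℕ} {A : Matrix (Fin n) (Fin L) ℝ} (hA : (Aᵀ * A).det ≠ 0)
    (v : ℝ≥0) {ε : ℝ} (h0 : 0 ≤ ε) (h1 : ε ≤ 1) :
    (Measure.pi fun _ : Fin n => gaussianReal 0 v)
      {r | (1 + ε) * (v * L) < projSq A r} ≤
        ENNReal.ofReal (Real.exp (-(L * ε ^ 2 / 16))) := by
  obtain ⟨Z, M, hZ, hM, rfl⟩ := exists_orthonormal_mul A hA
  simp_rw [projSq_mul hZ hM]
  have hS : MeasurableSet {g : Fin L → ℝ | (1 + ε) * (v * L) < ∑ l, g l ^ 2} :=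
    measurableSet_lt (by fun_prop) (by fun_prop)
  refine (pi_gaussianReal_transpose_preimage v hZ hS).trans_le ?_
  rw [ENNReal.le_ofReal_iff_toReal_le (measure_ne_top _ _) (Real.exp_pos _).le]
  refine le_trans (measureReal_mono ?_) (gaussian_upper_tail L h0 h1)
  intro z hz
  have hsq : √(v : ℝ) ^ 2 = v := Real.sq_sqrt v.2
  simp only [Set.mem_ofPred_eq, mul_pow, hsq, ← Finset.mul_sum] at hz ⊢
  rw [mul_left_comm] at hz
  exact (lt_of_mul_lt_mul_left hz v.2).le

theorem measure_prod_le_of_ae {α β : Type*} [MeasurableSpace α] [MeasurableSpace β]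
    (μ : Measure α) [IsProbabilityMeasure μ] (ν : Measure β) [SFinite ν]
    {B : Set (α × β)} (hB : MeasurableSet B) {δ : ENNReal}
    (h : ∀ᵐ a ∂μ, ν (Prod.mk a ⁻¹' B) ≤ δ) : (μ.prod ν) B ≤ δ := by
  rw [Measure.prod_apply hB]
  exact (lintegral_mono_ae h).trans (by simp)

/-- Both tail bounds when the matrix itself is random and independent of the noise. -/
theorem ae_projSq_tail {n L : ℕ} (hL : L ≤ n) {Ω : Type*} [MeasurableSpace Ω] {μ : Measure Ω}
    [IsProbabilityMeasure μ] {A : Ω → Fin n × Fin L → ℝ} {r : Ω → Fin n → ℝ} {w v : ℝ≥0}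
    (hw : w ≠ 0) (hA : HasLaw A (Measure.pi fun _ => gaussianReal 0 w) μ)
    (hr : HasLaw r (Measure.pi fun _ => gaussianReal 0 v) μ) (hAr : IndepFun A r μ)
    (b : Fin L → ℝ) {ε : ℝ} (h0 : 0 ≤ ε) (h1 : ε ≤ 1) :
    μ {ω | ¬ (((Matrix.of fun i l => A ω (i, l))ᵀ *
        (Matrix.of fun i l => A ω (i, l) : Matrix (Fin n) (Fin L) ℝ)).det ≠ 0 ∧
      (1 - ε) * (v * L) ≤ projSq (Matrix.of fun i l => A ω (i, l))
        ((Matrix.of fun i l => A ω (i, l)) *ᵥ b + r ω) ∧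
      projSq (Matrix.of fun i l => A ω (i, l)) (r ω) ≤ (1 + ε) * (v * L))} ≤
        2 * ENNReal.ofReal (Real.exp (-(L * ε ^ 2 / 16))) := by
  set δ := ENNReal.ofReal (Real.exp (-(L * ε ^ 2 / 16))) with hδ
  have hmap : μ.map (fun ω => (A ω, r ω)) =
      (Measure.pi fun _ => gaussianReal 0 w).prod (Measure.pi fun _ => gaussianReal 0 v) := by
    rw [(indepFun_iff_map_prod_eq_prod_map_map hA.aemeasurable hr.aemeasurable).1 hAr, hA.map_eq,
      hr.map_eq]
  have hmeas : AEMeasurable (fun ω => (A ω, r ω)) μ := hA.aemeasurable.prodMk hr.aemeasurable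
  have hdet : ∀ᵐ x ∂(Measure.pi fun _ : Fin n × Fin L => gaussianReal 0 w),
      ((Matrix.of fun i l => x (i, l))ᵀ *
      (Matrix.of fun i l => x (i, l) : Matrix (Fin n) (Fin L) ℝ)).det ≠ 0 :=
    ae_det_transpose_mul_self_ne_zero hL fun _ => gaussianReal_absolutelyContinuous 0 hw
  have hdet' : μ {ω | ¬ ((Matrix.of fun i l => A ω (i, l))ᵀ *
      (Matrix.of fun i l => A ω (i, l) : Matrix (Fin n) (Fin L) ℝ)).det ≠ 0} = 0 := by
    rw [← hA.map_eq] at hdet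
    exact ae_iff.1 (ae_of_ae_map hA.aemeasurable hdet)
  have hc : Continuous fun q : (Fin n × Fin L → ℝ) × (Fin n → ℝ) =>
      (q.1, (Matrix.of fun i l => q.1 (i, l)) *ᵥ b + q.2) := by
    refine continuous_fst.prodMk (Continuous.add ?_ continuous_snd)
    refine Continuous.matrix_mulVec (continuous_matrix fun i l => ?_) continuous_const
    simp only [Matrix.of_apply]
    fun_prop
  let Bl : Set ((Fin n × Fin L → ℝ) × (Fin n → ℝ)) :=
    {q | projSq (Matrix.of fun i l => q.1 (i, l)) ((Matrix.of fun i l => q.1 (i, l)) *ᵥ b + q.2) <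
      (1 - ε) * (v * L)}
  let Bu : Set ((Fin n × Fin L → ℝ) × (Fin n → ℝ)) :=
    {q | (1 + ε) * (v * L) < projSq (Matrix.of fun i l => q.1 (i, l)) q.2}
  have hBl : MeasurableSet Bl :=
    measurableSet_lt ((measurable_projSq n L).comp hc.measurable) measurable_const
  have hBu : MeasurableSet Bu := measurableSet_lt measurable_const (measurable_projSq n L)
  have hl : μ ((fun ω => (A ω, r ω)) ⁻¹' Bl) ≤ δ := by
    rw [← Measure.map_apply_of_aemeasurable hmeas hBl, hmap]
    refine measure_prod_le_of_ae _ _ hBl ?_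
    filter_upwards [hdet] with x hx
    exact projSq_lower_tail hx b v h0
  have hu : μ ((fun ω => (A ω, r ω)) ⁻¹' Bu) ≤ δ := by
    rw [← Measure.map_apply_of_aemeasurable hmeas hBu, hmap]
    refine measure_prod_le_of_ae _ _ hBu ?_
    filter_upwards [hdet] with x hx
    exact projSq_upper_tail hx v h0 h1
  refine (measure_mono (t := {ω | ¬ ((Matrix.of fun i l => A ω (i, l))ᵀ *
      (Matrix.of fun i l => A ω (i, l) : Matrix (Fin n) (Fin L) ℝ)).det ≠ 0} ∪
      (((fun ω => (A ω, r ω)) ⁻¹' Bl) ∪ ((fun ω => (A ω, r ω)) ⁻¹' Bu))) ?_).trans ?_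
  · intro ω hω
    simp only [Set.mem_ofPred_eq, not_and_or, not_le] at hω
    exact hω
  · refine (measure_union_le _ _).trans ?_
    rw [hdet', zero_add, two_mul]
    exact (measure_union_le _ _).trans (add_le_add hl hu)

/-! ### A single window -/

theorem windowIdx_injective {p L : ℕ} (j : Fin (p / L)) :
    Function.Injective (windowIdx j : Fin L → Fin p) := by
  intro a b h
  have := congrArg Fin.val h
  simp only [windowIdx] at this
  exact Fin.ext (by omega)

open Classical in
/-- With high probability, on a fixed window the regularized energy is at least its noise level,
and it is at most the total level if the window misses the support of `β`. -/
theorem window_tail {n p L : ℕ} (hn : n ≠ 0) (hL : L ≤ n) (β : Fin p → ℝ) (σ : ℝ≥0)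
    {Ω : Type*} [MeasurableSpace Ω] {μ : Measure Ω} [IsProbabilityMeasure μ]
    {X : Ω → Matrix (Fin n) (Fin p) ℝ} {η : Ω → Fin n → ℝ}
    (hX : ∀ i k, HasLaw (fun ω => X ω i k) (gaussianReal 0 (1 / (n : ℝ≥0))) μ)
    (hη : ∀ i, HasLaw (fun ω => η ω i) (gaussianReal 0 (σ ^ 2)) μ)
    (hind : iIndepFun (fun (e : (Fin n × Fin p) ⊕ Fin n) (ω : Ω) =>
        Sum.elim (fun ik : Fin n × Fin p => X ω ik.1 ik.2) (η ω) e) μ)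
    (j : Fin (p / L)) {ε : ℝ} (h0 : 0 ≤ ε) (h1 : ε ≤ 1) :
    μ {ω | ¬ ∀ Z : Matrix (Fin n) (Fin p) ℝ, IsRegularized L (X ω) Z →
      (1 - ε) * ((σ : ℝ) ^ 2 * L) ≤ ∑ l, (Zᵀ *ᵥ (X ω *ᵥ β + η ω)) (windowIdx j l) ^ 2 ∧
      ((∀ l, β (windowIdx j l) = 0) →
        ∑ l, (Zᵀ *ᵥ (X ω *ᵥ β + η ω)) (windowIdx j l) ^ 2 ≤
          (1 + ε) * (((σ : ℝ) ^ 2 + (∑ k, β k ^ 2) / n) * L))} ≤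
        2 * ENNReal.ofReal (Real.exp (-(L * ε ^ 2 / 16))) := by
  let ξ : (Fin n × Fin p) ⊕ Fin n → Ω → ℝ := fun e ω =>
    Sum.elim (fun ik : Fin n × Fin p => X ω ik.1 ik.2) (η ω) e
  let var : (Fin n × Fin p) ⊕ Fin n → ℝ≥0 := Sum.elim (fun _ => 1 / (n : ℝ≥0)) (fun _ => σ ^ 2)
  have hξ : ∀ e, HasLaw (ξ e) (gaussianReal 0 (var e)) μ := by
    rintro (⟨i, k⟩ | i)
    · exact hX i k
    · exact hη i
  let β' : Fin p → ℝ := fun k => if ∃ l, windowIdx j l = k then 0 else β k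
  have hβ'0 : ∀ l, β' (windowIdx j l) = 0 := fun l => if_pos ⟨l, rfl⟩
  have hβ'le : ∀ k, β' k ^ 2 ≤ β k ^ 2 := by
    intro k
    simp only [β']
    split_ifs
    · simpa using sq_nonneg (β k)
    · exact le_rfl
  -- `R` expresses `X β' + η` linearly in all the random entries. Its rows have disjoint supports,
  -- so the image has independent coordinates.
  let R : Matrix (Fin n) ((Fin n × Fin p) ⊕ Fin n) ℝ := Matrix.of fun i e =>
    Sum.elim (fun ik : Fin n × Fin p => if ik.1 = i then β' ik.2 else 0)
      (fun i' => if i' = i then 1 else 0) e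
  let v : ℝ≥0 := σ ^ 2 + (∑ k, ‖β' k‖₊ ^ 2) / n
  have hv : (v : ℝ) = (σ : ℝ) ^ 2 + (∑ k, β' k ^ 2) / n := by
    simp [v]
  let A : Ω → Fin n × Fin L → ℝ := fun ω il => X ω il.1 (windowIdx j il.2)
  let r : Ω → Fin n → ℝ := fun ω => R *ᵥ fun e => ξ e ω
  have hr_eq : ∀ ω, r ω = X ω *ᵥ β' + η ω := by
    intro ω
    ext i
    simp only [r, R, ξ, Matrix.mulVec, dotProduct, Fintype.sum_sum_type, Matrix.of_apply,
      Sum.elim_inl, Sum.elim_inr, Fintype.sum_prod_type, Pi.add_apply]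
    congr 1
    · rw [Finset.sum_eq_single i]
      · simp [mul_comm]
      · intro i' _ hi'
        simp [hi']
      · simp
    · simp
  have hy : ∀ ω, X ω *ᵥ β + η ω =
      (Matrix.of fun i l => A ω (i, l)) *ᵥ (fun l => β (windowIdx j l)) + r ω := by
    intro ω
    rw [hr_eq, ← add_assoc]
    congr 1
    ext i
    simp only [Matrix.mulVec, dotProduct, Pi.add_apply, Matrix.of_apply, A]
    have hsum : ∑ l, X ω i (windowIdx j l) * β (windowIdx j l) =
        ∑ k, X ω i k * (if ∃ l, windowIdx j l = k then β k else 0) := by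
      simp_rw [mul_ite, mul_zero]
      rw [← Finset.sum_filter]
      have himg : (Finset.univ.filter fun k => ∃ l, windowIdx j l = k) =
          Finset.univ.image (windowIdx j : Fin L → Fin p) := by
        ext k
        simp
      rw [himg, Finset.sum_image fun a _ b _ h => windowIdx_injective j h]
    rw [hsum, ← Finset.sum_add_distrib]
    refine Finset.sum_congr rfl fun k _ => ?_
    simp only [β']
    split_ifs <;> ring
  have hA : HasLaw A (Measure.pi fun _ => gaussianReal 0 (1 / (n : ℝ≥0))) μ := by
    refine iIndepFun.hasLaw_pi (X := fun il ω => A ω il) (fun il => hX _ _) ?_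
    exact hind.precomp (g := fun il : Fin n × Fin L => Sum.inl (il.1, windowIdx j il.2)) (by
      rintro ⟨a, b⟩ ⟨a', b'⟩ h
      simp only [Sum.inl.injEq, Prod.mk.injEq] at h
      exact Prod.ext h.1 (windowIdx_injective j h.2))
  have hr : HasLaw r (Measure.pi fun _ => gaussianReal 0 v) μ := by
    have h2 : HasLaw (fun ω e => ξ e ω) (Measure.pi fun e => gaussianReal 0 (var e)) μ :=
      iIndepFun.hasLaw_pi hξ hind
    refine HasLaw.comp (Y := (R *ᵥ ·)) ⟨(measurable_mulVec R).aemeasurable, ?_⟩ h2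
    refine map_mulVec_pi_gaussianReal var (fun _ => v) R fun t => ?_
    simp only [R, var, Fintype.sum_sum_type, Matrix.of_apply, Sum.elim_inl, Sum.elim_inr,
      Fintype.sum_prod_type, ite_mul, zero_mul, one_mul, Finset.sum_ite_eq, Finset.mem_univ,
      if_true, hv]
    rw [← Finset.sum_add_distrib]
    refine Finset.sum_congr rfl fun i _ => ?_
    simp only [mul_pow, ← mul_assoc, ← Finset.sum_mul, ← Finset.mul_sum]
    push_cast
    ring
  have hAr : IndepFun A r μ := by
    let S : Finset ((Fin n × Fin p) ⊕ Fin n) :=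
      Finset.univ.image fun il : Fin n × Fin L => Sum.inl (il.1, windowIdx j il.2)
    have h2 := hind.indepFun_finset₀ S Sᶜ disjoint_compl_right fun e => (hξ e).aemeasurable
    have hmem : ∀ il : Fin n × Fin L, (Sum.inl (il.1, windowIdx j il.2) :
        (Fin n × Fin p) ⊕ Fin n) ∈ S := fun il => Finset.mem_image_of_mem _ (Finset.mem_univ il)
    let φ : (S → ℝ) → Fin n × Fin L → ℝ := fun x il => x ⟨_, hmem il⟩
    let ψ : (↥(Sᶜ) → ℝ) → Fin n → ℝ := fun x i => ∑ e : ↥(Sᶜ), R i e * x e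
    have h3 := h2.comp (φ := φ) (ψ := ψ) (by fun_prop) (by fun_prop)
    have e1 : φ ∘ (fun ω (i : S) => Sum.elim (fun ik : Fin n × Fin p => X ω ik.1 ik.2) (η ω) i.1)
        = A := rfl
    have e2 : ψ ∘ (fun ω (i : ↥(Sᶜ)) =>
        Sum.elim (fun ik : Fin n × Fin p => X ω ik.1 ik.2) (η ω) i.1) = r := by
      funext ω i
      simp only [ψ, r, Function.comp, Matrix.mulVec, dotProduct]
      rw [Finset.sum_coe_sort Sᶜ (fun e => R i e * ξ e ω)]
      -- Since `β'` vanishes on the window, the columns of `R` in `S` are zero and `r` depends only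
      -- on entries outside the block.
      refine Finset.sum_subset (Finset.subset_univ _) fun e _ he => ?_
      rw [Finset.mem_compl, not_not, Finset.mem_image] at he
      obtain ⟨il, -, rfl⟩ := he
      simp [R, hβ'0]
    rwa [e1, e2] at h3
  have hw : (1 / (n : ℝ≥0)) ≠ 0 := by positivity
  refine (measure_mono ?_).trans
    (ae_projSq_tail hL hw hA hr hAr (fun l => β (windowIdx j l)) h0 h1)
  intro ω hω hgood
  refine hω fun Z hZ => ?_
  obtain ⟨hdet, hlow, hup⟩ := hgood
  obtain ⟨U, D, V, hsvd, hblock⟩ := hZ j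
  have hAω : (Matrix.of fun i l => A ω (i, l)) = block (X ω) j := rfl
  have hest : ∀ y, ∑ l, (Zᵀ *ᵥ y) (windowIdx j l) ^ 2 =
      projSq (Matrix.of fun i l => A ω (i, l)) y := by
    intro y
    rw [hAω, ← hsvd.sum_sq_eq_projSq hL hdet, ← hblock]
    rfl
  have hLnn : (0 : ℝ) ≤ L := Nat.cast_nonneg _
  have hsum0 : 0 ≤ (∑ k, β' k ^ 2) / n :=
    div_nonneg (Finset.sum_nonneg fun _ _ => sq_nonneg _) (Nat.cast_nonneg _)
  rw [hest]
  constructor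
  · rw [hy]
    refine le_trans ?_ hlow
    refine mul_le_mul_of_nonneg_left (mul_le_mul_of_nonneg_right ?_ hLnn) (by linarith)
    rw [hv]
    linarith
  · intro hz
    have : X ω *ᵥ β + η ω = r ω := by
      rw [hy, show (fun l => β (windowIdx j l)) = 0 from funext hz, Matrix.mulVec_zero, zero_add]
    rw [this]
    refine hup.trans ?_
    refine mul_le_mul_of_nonneg_left (mul_le_mul_of_nonneg_right ?_ hLnn) (by linarith)
    rw [hv]
    have := Finset.sum_le_sum fun k (_ : k ∈ Finset.univ) => hβ'le k
    gcongr

/-! ### Order statistics and the deterministic estimate -/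

theorem sort_le_of_card_filter_le {m k : ℕ} (f : Fin m → ℝ) (B : ℝ)
    (h : (Finset.univ.filter fun i => B < f i).card ≤ m - k) (i : Fin m) (hi : (i : ℕ) < k) :
    f (Tuple.sort f i) ≤ B := by
  by_contra! hB
  have hsub : (Finset.Ici i).image (Tuple.sort f) ⊆ Finset.univ.filter fun i => B < f i := by
    intro a ha
    obtain ⟨b, hb, rfl⟩ := Finset.mem_image.1 ha
    rw [Finset.mem_filter]
    exact ⟨Finset.mem_univ _, hB.trans_le (Tuple.monotone_sort f (Finset.mem_Ici.1 hb))⟩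
  have hcard := Finset.card_le_card hsub
  rw [Finset.card_image_of_injective _ (Tuple.sort f).injective, Fin.card_Ici] at hcard
  have := i.isLt
  omega

/-- The windows are disjoint: a support index `k` determines its window as `k / L`. -/
theorem card_windows_meeting_support_le {p L : ℕ} (β : Fin p → ℝ) :
    (Finset.univ.filter fun j : Fin (p / L) => ∃ l, β (windowIdx j l) ≠ 0).card ≤
      (Function.support β).ncard := by
  classical
  rw [← Set.ncard_coe_finset]
  have hex : ∀ j : Fin (p / L), (∃ l : Fin L, β (windowIdx j l) ≠ 0) →
      ∃ k, β k ≠ 0 ∧ (k : ℕ) / L = j := by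
    rintro j ⟨l, hl⟩
    refine ⟨_, hl, ?_⟩
    have hL : 0 < L := l.pos
    simp only [windowIdx]
    rw [Nat.mul_comm, Nat.mul_add_div hL, Nat.div_eq_of_lt l.isLt, Nat.add_zero]
  rcases isEmpty_or_nonempty (Fin p) with hp | hp
  · rw [Finset.filter_false_of_mem fun j _ ⟨l, _⟩ => hp.elim (windowIdx j l)]
    simp
  choose! g hg using hex
  refine Set.ncard_le_ncard_of_injOn g ?_ ?_ (Set.toFinite _)
  · intro j hj
    exact (hg j (by simpa using hj)).1
  · intro a ha b hb hab
    have h1 := (hg a (by simpa using ha)).2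
    have h2 := (hg b (by simpa using hb)).2
    rw [hab] at h1
    exact Fin.ext (h1.symm.trans h2)

theorem abs_varianceEst_sub_le {s n p L : ℕ} (hs : 2 ≤ s) (hL0 : 0 < L) (hLs : L * (2 * s) ≤ n)
    (hnp : n < p) {β : Fin p → ℝ} (hβ : (Function.support β).ncard ≤ s) {σ N ε : ℝ}
    (hN : 0 ≤ N) (h0 : 0 ≤ ε) (h1 : ε ≤ 1) (hsε : 1 / (s : ℝ) ≤ ε)
    (Z : Matrix (Fin n) (Fin p) ℝ) (y : Fin n → ℝ)
    (hlow : ∀ j : Fin (p / L), (1 - ε) * (σ ^ 2 * L) ≤ ∑ l, (Zᵀ *ᵥ y) (windowIdx j l) ^ 2)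
    (hup : ∀ j : Fin (p / L), (∀ l, β (windowIdx j l) = 0) →
      ∑ l, (Zᵀ *ᵥ y) (windowIdx j l) ^ 2 ≤ (1 + ε) * ((σ ^ 2 + N / n) * L)) :
    |varianceEst L Z y - σ ^ 2| ≤ 2 * s * N / n + 2 * σ ^ 2 * ε := by
  have hLpos : (0 : ℝ) < L := by exact_mod_cast hL0
  have hspos : (0 : ℝ) < s := by exact_mod_cast (by omega : 0 < s)
  have hp : (0 : ℝ) < p := by exact_mod_cast (by omega : 0 < p)
  have hn : (0 : ℝ) < n := by
    exact_mod_cast lt_of_lt_of_le (Nat.mul_pos hL0 (by omega : 0 < 2 * s)) hLs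
  have hT : ∀ j : Fin (p / L), windowEst L Z y j =
      (∑ l, (Zᵀ *ᵥ y) (windowIdx j l) ^ 2) / L := by
    intro j
    simp only [windowEst, sq_abs]
    ring
  have hTlow : ∀ j : Fin (p / L), (1 - ε) * σ ^ 2 ≤ windowEst L Z y j := by
    intro j
    rw [hT, le_div_iff₀ hLpos, mul_assoc]
    exact hlow j
  have hTup : ∀ j : Fin (p / L), (∀ l, β (windowIdx j l) = 0) →
      windowEst L Z y j ≤ (1 + ε) * (σ ^ 2 + N / n) := by
    intro j hj
    rw [hT, div_le_iff₀ hLpos, mul_assoc]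
    exact hup j hj
  set k := p / (2 * L) with hk
  have hkm : 2 * k ≤ p / L := by
    rw [hk, Nat.mul_comm 2 L, ← Nat.div_div_eq_div_mul]
    exact Nat.mul_div_le _ _
  -- Because `2 * L * s ≤ n < p`. Together with `2 * k ≤ p / L`, the discarded windows number at
  -- least `s`.
  have hks : s ≤ k := by
    rw [hk, Nat.le_div_iff_mul_le (by omega)]
    nlinarith
  have hcount : (Finset.univ.filter fun j => (1 + ε) * (σ ^ 2 + N / n) <
      windowEst L Z y j).card ≤ p / L - k := by
    have h2 : (Finset.univ.filter fun j => (1 + ε) * (σ ^ 2 + N / n) < windowEst L Z y j) ⊆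
        Finset.univ.filter fun j : Fin (p / L) => ∃ l, β (windowIdx j l) ≠ 0 := by
      intro j hj
      simp only [Finset.mem_filter, Finset.mem_univ, true_and] at hj ⊢
      by_contra! hz
      exact absurd hj (not_lt.2 (hTup j hz))
    have := (Finset.card_le_card h2).trans ((card_windows_meeting_support_le β).trans hβ)
    omega
  have hsortup : ∀ j : Fin k, windowEst L Z y (Tuple.sort (windowEst L Z y)
      (Fin.castLE (div_two_mul_le p L) j)) ≤ (1 + ε) * (σ ^ 2 + N / n) := fun j =>
    sort_le_of_card_filter_le _ _ hcount _ j.isLt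
  have hsumup := Finset.sum_le_card_nsmul Finset.univ _ _ fun j _ => hsortup j
  have hsumlow := Finset.card_nsmul_le_sum Finset.univ (fun j : Fin k => windowEst L Z y
    (Tuple.sort (windowEst L Z y) (Fin.castLE (div_two_mul_le p L) j))) ((1 - ε) * σ ^ 2)
    fun j _ => hTlow _
  simp only [Finset.card_univ, Fintype.card_fin, nsmul_eq_mul] at hsumup hsumlow
  have hvar : varianceEst L Z y = (2 * (L : ℝ) / p) * ∑ j : Fin k, windowEst L Z y
    (Tuple.sort (windowEst L Z y) (Fin.castLE (div_two_mul_le p L) j)) := rfl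
  have hc : 0 ≤ 2 * (L : ℝ) / p := by positivity
  have hup' := mul_le_mul_of_nonneg_left hsumup hc
  have hlow' := mul_le_mul_of_nonneg_left hsumlow hc
  rw [← hvar, ← mul_assoc] at hup' hlow'
  have ha1 : 2 * (L : ℝ) / p * k ≤ 1 := by
    rw [div_mul_eq_mul_div, div_le_one hp]
    exact_mod_cast Nat.mul_div_le p (2 * L)
  -- The floor in `k` loses at most `2 * L / p ≤ 1 / s ≤ ε` of the normalization.
  have ha2 : 1 - ε ≤ 2 * (L : ℝ) / p * k := by
    have h3 : p < 2 * L * (k + 1) := Nat.lt_mul_div_succ p (by omega)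
    have h3' : (p : ℝ) < 2 * L * (k + 1) := by exact_mod_cast h3
    have h4 : 1 ≤ 2 * (L : ℝ) / p * k + 2 * L / p := by
      have : 2 * (L : ℝ) / p * k + 2 * L / p = 2 * L * (k + 1) / p := by ring
      rw [this, le_div_iff₀ hp]
      linarith
    have h5 : 2 * (L : ℝ) / p ≤ 1 / s := by
      rw [div_le_div_iff₀ hp hspos]
      have : L * (2 * s) ≤ p := by omega
      have : (L : ℝ) * (2 * s) ≤ p := by exact_mod_cast this
      linarith
    linarith
  have hNn : 0 ≤ N / n := by positivity
  have hB : 0 ≤ (1 + ε) * (σ ^ 2 + N / n) := by positivity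
  have hA : 0 ≤ (1 - ε) * σ ^ 2 := mul_nonneg (by linarith) (sq_nonneg _)
  have hU := hup'.trans (mul_le_of_le_one_left hB ha1)
  have hLo := (mul_le_mul_of_nonneg_right ha2 hA).trans hlow'
  have hsN : 2 * (N / n) ≤ 2 * s * N / n := by
    have : 2 * (s : ℝ) * N / n = s * (2 * (N / n)) := by ring
    rw [this]
    exact le_mul_of_one_le_left (by positivity) (by exact_mod_cast (by omega : 1 ≤ s))
  have hsq := sq_nonneg σ
  rw [abs_le]
  constructor
  · nlinarith [mul_nonneg (sq_nonneg ε) hsq]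
  · nlinarith [mul_nonneg (sub_nonneg.2 h1) hNn, mul_nonneg h0 hsq]

end GVE

/-! ### Choice of constants and union bound -/

theorem corollary1 :
    ∃ C : ℝ, 0 < C ∧
      ∀ (s n p : ℕ), s < n → n < p →
      C * s * Real.log p ^ 3 / n < 1 → 1 ≤ (s : ℝ) ^ 2 / n →
      ∀ (β : EuclideanSpace ℝ (Fin p)), (Function.support β.ofLp).ncard ≤ s →
      ∀ (σ : ℝ≥0)
        (Ω : Type*) [MeasurableSpace Ω] (μ : Measure Ω) [IsProbabilityMeasure μ]
        (X : Ω → Matrix (Fin n) (Fin p) ℝ) (η : Ω → Fin n → ℝ),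
      (∀ i k, HasLaw (fun ω => X ω i k) (gaussianReal 0 (1 / (n : ℝ≥0))) μ) →
      (∀ i, HasLaw (fun ω => η ω i) (gaussianReal 0 (σ ^ 2)) μ) →
      iIndepFun (fun (e : (Fin n × Fin p) ⊕ Fin n) (ω : Ω) =>
        Sum.elim (fun ik : Fin n × Fin p => X ω ik.1 ik.2) (η ω) e) μ →
      ∃ E : Set Ω, MeasurableSet E ∧
        1 - 4 / (p : ℝ) - 2 * ((s : ℝ) / (p : ℝ)) ^ s ≤ μ.real E ∧
        ∀ ω ∈ E, ∀ Z : Matrix (Fin n) (Fin p) ℝ, GVE.IsRegularized (n / (2 * s)) (X ω) Z →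
          |GVE.varianceEst (n / (2 * s)) Z (X ω *ᵥ β.ofLp + η ω) - (σ : ℝ) ^ 2| ≤
            2 * s * ‖β‖ ^ 2 / n + 5 * (σ : ℝ) ^ 2 / Real.log p
              + 8 * (σ : ℝ) ^ 2 * s * Real.log p / n
              + 16 * s * σ * ‖β‖ ^ 2 * √(Real.log p) / n := by
  -- `128` gives `L ≥ 32 log³ p` after rounding down (`n < 2s(L + 1) ≤ 4sL`), so with `ε = 1 / log
  -- p` the tail exponent `Lε² / 16` is at least `2 log p`.
  refine ⟨128, by norm_num, ?_⟩
  intro s n p hsn hnp hC hsn2 β hβ σ Ω _ μ _ X η hX hη hind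
  have hn : (0 : ℝ) < n := by exact_mod_cast (by omega : 0 < n)
  have hp : (0 : ℝ) < p := by exact_mod_cast (by omega : 0 < p)
  rw [div_lt_one hn] at hC
  rw [le_div_iff₀ hn, one_mul] at hsn2
  have hsn2' : n ≤ s ^ 2 := by exact_mod_cast hsn2
  have hs : 2 ≤ s := by
    by_contra! h
    interval_cases s <;> omega
  have hspos : (0 : ℝ) < s := by exact_mod_cast (by omega : 0 < s)
  have hlog : 1 ≤ Real.log p := by
    rw [Real.le_log_iff_exp_le hp]
    have h4 : (4 : ℝ) ≤ p := by exact_mod_cast (by omega : 4 ≤ p)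
    linarith [Real.exp_one_lt_d9]
  set lp := Real.log p with hlp
  have hlp0 : 0 < lp := by linarith
  have hlp3 : lp ≤ lp ^ 3 := le_self_pow₀ hlog (by norm_num)
  set L := n / (2 * s) with hLdef
  have hLs : L * (2 * s) ≤ n := Nat.div_mul_le_self _ _
  have hL0 : 0 < L := by
    refine Nat.div_pos ?_ (by omega)
    have : (2 * s : ℝ) ≤ n := by nlinarith
    exact_mod_cast this
  have hLn : L ≤ n := Nat.div_le_self _ _
  have hLbig : 32 * lp ^ 3 ≤ L := by
    have h1 : n < 2 * s * (L + 1) := Nat.lt_mul_div_succ n (by omega)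
    have h2 : n ≤ s * (4 * L) := by nlinarith
    have h2' : (n : ℝ) ≤ s * (4 * L) := by exact_mod_cast h2
    have h3 : (s : ℝ) * (128 * lp ^ 3) ≤ s * (4 * L) := by linarith
    linarith [le_of_mul_le_mul_left h3 hspos]
  have hslp : lp ≤ s := by
    -- Here `n ≤ s²` enters: it forces `s ≥ log p`, hence `1 / s ≤ ε`.
    have h3 : (s : ℝ) * (128 * lp ^ 3) ≤ s * s := by nlinarith
    have h4 := le_of_mul_le_mul_left h3 hspos
    linarith
  have hε0 : 0 ≤ 1 / lp := by positivity
  have hε1 : 1 / lp ≤ 1 := by rw [div_le_one hlp0]; exact hlog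
  have hsε : 1 / (s : ℝ) ≤ 1 / lp := one_div_le_one_div_of_le hlp0 hslp
  have hδ : Real.exp (-(L * (1 / lp) ^ 2 / 16)) ≤ 1 / (p : ℝ) ^ 2 := by
    have h1 : 2 * lp ≤ L * (1 / lp) ^ 2 / 16 := by
      rw [one_div_pow, mul_one_div, div_div, le_div_iff₀ (by positivity)]
      linarith
    have h2 : Real.exp (2 * lp) = (p : ℝ) ^ 2 := by
      rw [two_mul, Real.exp_add, hlp, Real.exp_log hp, pow_two]
    rw [← h2, one_div (Real.exp _), ← Real.exp_neg]
    exact Real.exp_le_exp.2 (by linarith)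
  let bad : Fin (p / L) → Set Ω := fun j =>
    {ω | ¬ ∀ Z : Matrix (Fin n) (Fin p) ℝ, GVE.IsRegularized L (X ω) Z →
      (1 - 1 / lp) * ((σ : ℝ) ^ 2 * L) ≤
        ∑ l, (Zᵀ *ᵥ (X ω *ᵥ β.ofLp + η ω)) (GVE.windowIdx j l) ^ 2 ∧
      ((∀ l, β.ofLp (GVE.windowIdx j l) = 0) →
        ∑ l, (Zᵀ *ᵥ (X ω *ᵥ β.ofLp + η ω)) (GVE.windowIdx j l) ^ 2 ≤
          (1 + 1 / lp) * (((σ : ℝ) ^ 2 + (∑ k, β.ofLp k ^ 2) / n) * L))}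
  have hbad : ∀ j, μ (bad j) ≤ ENNReal.ofReal (2 / (p : ℝ) ^ 2) := by
    intro j
    refine (GVE.window_tail (by omega) hLn β.ofLp σ hX hη hind j hε0 hε1).trans ?_
    rw [← ENNReal.ofReal_ofNat 2, ← ENNReal.ofReal_mul (by norm_num)]
    refine ENNReal.ofReal_le_ofReal ?_
    calc _ ≤ 2 * (1 / (p : ℝ) ^ 2) := by gcongr
      _ = _ := by ring
  have hbadU : μ.real (⋃ j, bad j) ≤ 2 / (p : ℝ) := by
    refine ENNReal.toReal_le_of_le_ofReal (by positivity) ?_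
    refine (measure_iUnion_fintype_le μ bad).trans ((Finset.sum_le_sum fun j _ => hbad j).trans ?_)
    rw [Finset.sum_const, Finset.card_univ, Fintype.card_fin, ← ENNReal.ofReal_nsmul]
    refine ENNReal.ofReal_le_ofReal ?_
    have hm : ((p / L : ℕ) : ℝ) ≤ p := by exact_mod_cast Nat.div_le_self p L
    rw [nsmul_eq_mul]
    calc _ ≤ (p : ℝ) * (2 / (p : ℝ) ^ 2) := by gcongr
      _ = _ := by field_simp
  -- The bad sets quantify over all `Z` and are not known to be measurable, so a measurable hull of
  -- the same measure is removed.
  refine ⟨(toMeasurable μ (⋃ j, bad j))ᶜ, (measurableSet_toMeasurable _ _).compl, ?_, ?_⟩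
  · rw [probReal_compl_eq_one_sub (measurableSet_toMeasurable _ _), measureReal_def,
      measure_toMeasurable, ← measureReal_def]
    have h1 : (2 : ℝ) / p ≤ 4 / p := by gcongr; norm_num
    have h2 : 0 ≤ 2 * ((s : ℝ) / p) ^ s := by positivity
    linarith
  · intro ω hω Z hZ
    have hgood : ∀ j, ω ∉ bad j := fun j hj =>
      hω (subset_toMeasurable μ _ (Set.mem_iUnion.2 ⟨j, hj⟩))
    have hgood' := fun j => not_not.1 (hgood j) Z hZ
    have hnorm : ‖β‖ ^ 2 = ∑ k, β.ofLp k ^ 2 := EuclideanSpace.real_norm_sq_eq β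
    have key := GVE.abs_varianceEst_sub_le hs hL0 hLs hnp hβ (sq_nonneg ‖β‖) hε0 hε1 hsε Z
      (X ω *ᵥ β.ofLp + η ω) (fun j => (hgood' j).1) (fun j hj => by
        rw [hnorm]; exact (hgood' j).2 hj)
    refine key.trans ?_
    have h1 : 2 * (σ : ℝ) ^ 2 * (1 / lp) ≤ 5 * (σ : ℝ) ^ 2 / lp := by
      rw [mul_one_div]
      gcongr
      norm_num
    have h2 : 0 ≤ 8 * (σ : ℝ) ^ 2 * s * lp / n := by positivity
    have h3 : 0 ≤ 16 * s * (σ : ℝ) * ‖β‖ ^ 2 * √lp / n := by positivity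
    linarith
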